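/- Modules are left modules and noetherian means left noetherian. Let $A=\bigoplus_{i\ge 0}A_i$ be an $\mathbb{N}$-graded ring such that $A_0$ is noetherian and semiperfect, each $A_i$ is a finitely generated left $A_0$-module, and $A_iA_j=A_{i+j}$ for all $i,j\ge 0$. Let $J=J(A_0)\oplus A_{\ge 1}$ be its graded Jacobson radical, where $J(A_0)$ is the Jacobson radical of $A_0$. For a ($\mathbb{Z}$-)graded $A$-module $M$ put $\operatorname{Gr}_J A=\bigoplus_{n\ge 0}J^n/J^{n+1}$ and $\operatorname{Gr}_J M=\bigoplus_{n\ge 0}J^nM/J^{n+1}M$, graded by $n$. A graded $A$-module $M$ is called Koszul if it has a graded projective resolution $\cdots\to P_1\xrightarrow{d_1}P_0\xrightarrow{d_0}M\to 0$ that is minimal ($\operatorname{im} d_{n+1}\subseteq JP_n$ for all $n\ge 0$) and satisfies $J^k\operatorname{Ker} d_n=\operatorname{Ker} d_n\cap J^{k+1}P_n$ for all $n,k\ge 0$. The ring $A$ is called Koszul if the graded $A$-module $A/J$ is Koszul. Over an $\mathbb{N}$-graded ring $B$ with $B_0$ artinian semisimple, a graded $B$-module $N$ is called classically Koszul if it is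 generated in degree $0$ and has a graded projective resolution $\cdots\to Q_1\to Q_0\to N\to 0$ with $Q_n$ generated in degree $n$ for every $n\ge 0$; $B$ is called classically Koszul if the graded $B$-module $B_0=B/B_{\ge 1}$ is classically Koszul. Then: 1. If $M$ is a Koszul $A$-module, then $\operatorname{Gr}_J M$ is a classically Koszul $\operatorname{Gr}_J A$-module (in particular $(\operatorname{Gr}_J A)_0$ is artinian semisimple). 2. If $A$ is a Koszul ring, then $\operatorname{Gr}_J A$ is a classically Koszul ring. -/

import Mathlib

open DirectSum

universe u v w

namespace GradedKoszul

/-! ### Rings -/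

/-- A ring `R` is semiperfect if `R / J(R)` is (artinian) semisimple and idempotents of `R / J(R)`
lift to `R`, where `J(R)` is the Jacobson radical. -/
structure IsSemiperfectRing (R : Type u) [Ring R] : Prop where
  semisimple : IsSemisimpleRing (R ⧸ Ring.jacobson R)
  lift : ∀ e : R ⧸ Ring.jacobson R, IsIdempotentElem e →
    ∃ f : R, IsIdempotentElem f ∧ Ideal.Quotient.mk (Ring.jacobson R) f = e

section Graded

variable {A : Type u} [Ring A] (𝒜 : ℕ → AddSubgroup A) [GradedRing 𝒜]

/-- Every `A_i` is finitely generated as a left module over the subring `A_0`. -/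
def LeftFinite : Prop :=
  ∀ i, ∃ s : Finset A,
    (Submodule.span (SetLike.GradeZero.subring 𝒜) (s : Set A) : Set A) = (𝒜 i : Set A)

open scoped Pointwise in
/-- `A_i A_j = A_{i+j}` for all `i, j`, where the product is the additive subgroup generated by
the products of elements. -/
def GeneratedInDegreeOne : Prop :=
  ∀ i j, 𝒜 i * 𝒜 j = 𝒜 (i + j)

/-- The graded Jacobson radical `J = J(A_0) ⊕ A_{≥ 1}`: the elements whose degree zero component
lies in the Jacobson radical of `A_0`. -/
def gradedJacobson : Ideal A :=
  (Ring.jacobson (𝒜 0)).comap (GradedRing.projZeroRingHom' 𝒜)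

instance : (gradedJacobson 𝒜).IsTwoSided := by
  unfold gradedJacobson; infer_instance

/-- The ideal `A_{≥ 1}`: the elements whose degree zero component vanishes. -/
def positivePart : Ideal A := RingHom.ker (GradedRing.projZeroRingHom' 𝒜)

end Graded

/-! ### Graded modules

Modules are left modules, graded by the integers. -/

/-- An `ℕ`-indexed family, regarded as a `ℤ`-indexed one vanishing in negative degrees. -/
def extendByBot {V : Type u} [AddGroup V] (𝒱 : ℕ → AddSubgroup V) : ℤ → AddSubgroup V
  | .ofNat n => 𝒱 n
  | .negSucc _ => ⊥

section Modules

variable {A : Type u} [Ring A] (𝒜 : ℕ → AddSubgroup A)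
variable {M : Type v} [AddCommGroup M] [Module A M]

/-- `M` is the internal direct sum of the `M_j`, and `A_i M_j ⊆ M_{i+j}`. -/
structure IsGradedModule (ℳ : ℤ → AddSubgroup M) : Prop where
  isInternal : DirectSum.IsInternal ℳ
  smul_mem : ∀ (i : ℕ) (j : ℤ) (a : A) (m : M), a ∈ 𝒜 i → m ∈ ℳ j → a • m ∈ ℳ (i + j)

variable (A) in
/-- `M` is generated as an `A`-module by its component of degree `i`. -/
def GeneratedInDegree (ℳ : ℤ → AddSubgroup M) (i : ℤ) : Prop :=
  Submodule.span A (ℳ i : Set M) = ⊤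

/-- The grading of `A / I` induced by the grading of `A` (for `I` a graded left ideal). -/
def quotientGrading (I : Ideal A) : ℤ → AddSubgroup (A ⧸ I) :=
  extendByBot fun n => (𝒜 n).map I.mkQ.toAddMonoidHom

/-- A graded projective resolution `⋯ → P 1 → P 0 → M → 0` of a graded `A`-module `M`: the modules
`P n` are graded and projective, the maps preserve degrees and the sequence is exact. -/
structure GradedProjectiveResolution (ℳ : ℤ → AddSubgroup M) where
  P : ℕ → Type w
  [addCommGroup : ∀ n, AddCommGroup (P n)]
  [module : ∀ n, Module A (P n)]
  grading : ∀ n, ℤ → AddSubgroup (P n)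
  isGraded : ∀ n, IsGradedModule 𝒜 (grading n)
  projective : ∀ n, Module.Projective A (P n)
  /-- the differential `P (n + 1) → P n` -/
  d : ∀ n, P (n + 1) →ₗ[A] P n
  /-- the augmentation `P 0 → M` -/
  ε : P 0 →ₗ[A] M
  d_mem : ∀ n i x, x ∈ grading (n + 1) i → d n x ∈ grading n i
  ε_mem : ∀ i x, x ∈ grading 0 i → ε x ∈ ℳ i
  exact : ∀ n, Function.Exact (d (n + 1)) (d n)
  exact_zero : Function.Exact (d 0) ε
  surjective : Function.Surjective ε

attribute [instance] GradedProjectiveResolution.addCommGroup GradedProjectiveResolution.module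

namespace GradedProjectiveResolution

variable {𝒜} {ℳ : ℤ → AddSubgroup M} (R : GradedProjectiveResolution.{u, v, w} 𝒜 ℳ)

/-- The kernel, inside `P n`, of the map leaving `P n` (that is `P n → P (n - 1)`, or the
augmentation `P 0 → M` for `n = 0`). -/
def kernel : ∀ n, Submodule A (R.P n)
  | 0 => LinearMap.ker R.ε
  | n + 1 => LinearMap.ker (R.d n)

/-- The image of `P (n + 1) → P n` is contained in `J (P n)`. -/
def IsMinimal [GradedRing 𝒜] : Prop :=
  ∀ n, LinearMap.range (R.d n) ≤ gradedJacobson 𝒜 • (⊤ : Submodule A (R.P n))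

/-- `P n` is generated in degree `n`. -/
def IsLinear : Prop :=
  ∀ n : ℕ, GeneratedInDegree A (R.grading n) n

end GradedProjectiveResolution

variable [GradedRing 𝒜]

/-- A graded module is Koszul if it has a minimal graded projective resolution such that
`J^k Ker d_n = Ker d_n ∩ J^{k+1} P_n` for all `n, k ≥ 0`. -/
def IsKoszulModule (ℳ : ℤ → AddSubgroup M) : Prop :=
  IsGradedModule 𝒜 ℳ ∧
  ∃ R : GradedProjectiveResolution.{u, v, max u v} 𝒜 ℳ, R.IsMinimal ∧
    ∀ n k : ℕ, gradedJacobson 𝒜 ^ k • R.kernel n =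
      R.kernel n ⊓ gradedJacobson 𝒜 ^ (k + 1) • (⊤ : Submodule A (R.P n))

/-- `A` is a Koszul ring if `A / J` is a Koszul module. -/
def IsKoszulRing : Prop :=
  IsKoszulModule 𝒜 (quotientGrading 𝒜 (gradedJacobson 𝒜))

/-- Classically Koszul modules over a graded ring `A` with `A_0` artinian semisimple: graded modules
generated in degree `0` that have a linear graded projective resolution. -/
def IsClassicallyKoszulModule (ℳ : ℤ → AddSubgroup M) : Prop :=
  IsSemisimpleRing (𝒜 0) ∧ IsGradedModule 𝒜 ℳ ∧ GeneratedInDegree A ℳ 0 ∧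
  ∃ R : GradedProjectiveResolution.{u, v, max u v} 𝒜 ℳ, R.IsLinear

/-- `A` is a classically Koszul ring if `A_0`, that is the graded module `A / A_{≥ 1}`, is a
classically Koszul module. -/
def IsClassicallyKoszulRing : Prop :=
  IsClassicallyKoszulModule 𝒜 (quotientGrading 𝒜 (positivePart 𝒜))

end Modules

/-! ### Associated graded rings and modules of adic filtrations -/

section Gr

variable {A : Type u} [Ring A] (I : Ideal A) (M : Type v) [AddCommGroup M] [Module A M]

/-- `I^n / I^{n+1}` -/
def GrRingPiece (n : ℕ) : Type u := ↥(I ^ n) ⧸ (I ^ (n + 1)).submoduleOf (I ^ n)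

/-- `I^n M / I^{n+1} M` -/
def GrModulePiece (n : ℕ) : Type v :=
  ↥(I ^ n • (⊤ : Submodule A M)) ⧸
    (I ^ (n + 1) • (⊤ : Submodule A M)).submoduleOf (I ^ n • (⊤ : Submodule A M))

instance (n : ℕ) : AddCommGroup (GrRingPiece I n) :=
  inferInstanceAs (AddCommGroup (↥(I ^ n) ⧸ (I ^ (n + 1)).submoduleOf (I ^ n)))

instance (n : ℕ) : AddCommGroup (GrModulePiece I M n) :=
  inferInstanceAs (AddCommGroup (↥(I ^ n • (⊤ : Submodule A M)) ⧸
    (I ^ (n + 1) • (⊤ : Submodule A M)).submoduleOf (I ^ n • (⊤ : Submodule A M))))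

/-- The associated graded ring `⨁ I^n / I^{n+1}`. -/
abbrev GrRing : Type u := ⨁ n, GrRingPiece I n

/-- The associated graded module `⨁ I^n M / I^{n+1} M`, a module over `GrRing I`. -/
abbrev GrModule : Type v := ⨁ n, GrModulePiece I M n

/-- The class in `I^n / I^{n+1}` of an element of `I^n`. -/
def GrRingPiece.mk (n : ℕ) : ↥(I ^ n) →+ GrRingPiece I n :=
  ((I ^ (n + 1)).submoduleOf (I ^ n)).mkQ.toAddMonoidHom

/-- The class in `I^n M / I^{n+1} M` of an element of `I^n M`. -/
def GrModulePiece.mk (n : ℕ) : ↥(I ^ n • (⊤ : Submodule A M)) →+ GrModulePiece I M n :=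
  ((I ^ (n + 1) • (⊤ : Submodule A M)).submoduleOf (I ^ n • (⊤ : Submodule A M))).mkQ.toAddMonoidHom

variable {I M}

theorem GrRingPiece.mk_surjective (n : ℕ) : Function.Surjective (GrRingPiece.mk I n) :=
  Submodule.mkQ_surjective _

theorem GrModulePiece.mk_surjective (n : ℕ) : Function.Surjective (GrModulePiece.mk I M n) :=
  Submodule.mkQ_surjective _

theorem GrRingPiece.mk_eq_iff {n : ℕ} (x y : ↥(I ^ n)) :
    GrRingPiece.mk I n x = GrRingPiece.mk I n y ↔ (x - y : A) ∈ I ^ (n + 1) :=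
  Submodule.Quotient.eq _

theorem GrModulePiece.mk_eq_iff {n : ℕ} (x y : ↥(I ^ n • (⊤ : Submodule A M))) :
    GrModulePiece.mk I M n x = GrModulePiece.mk I M n y ↔
      (x - y : M) ∈ I ^ (n + 1) • (⊤ : Submodule A M) :=
  Submodule.Quotient.eq _

/-- Classes of the same element in (propositionally) equal degrees agree. -/
theorem GrRingPiece.sigma_eq {m n : ℕ} (h : m = n) (x : ↥(I ^ m)) (y : ↥(I ^ n))
    (hxy : (x : A) = y) :
    GradedMonoid.mk (A := GrRingPiece I) m (GrRingPiece.mk I m x) =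
      GradedMonoid.mk n (GrRingPiece.mk I n y) := by
  subst h
  rw [Subtype.ext hxy]

theorem GrModulePiece.sigma_eq {m n : ℕ} (h : m = n) (x : ↥(I ^ m • (⊤ : Submodule A M)))
    (y : ↥(I ^ n • (⊤ : Submodule A M))) (hxy : (x : M) = y) :
    GradedMonoid.mk (A := GrModulePiece I M) m (GrModulePiece.mk I M m x) =
      GradedMonoid.mk n (GrModulePiece.mk I M n y) := by
  subst h
  rw [Subtype.ext hxy]

variable [I.IsTwoSided]

theorem pow_mul_mem {i j : ℕ} {a b : A} (ha : a ∈ I ^ i) (hb : b ∈ I ^ j) :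
    a * b ∈ I ^ (i + j) := by
  rw [Ideal.IsTwoSided.pow_add]
  exact Ideal.mul_mem_mul ha hb

theorem pow_smul_mem {i j : ℕ} {a : A} {m : M} (ha : a ∈ I ^ i)
    (hm : m ∈ I ^ j • (⊤ : Submodule A M)) : a • m ∈ I ^ (i + j) • (⊤ : Submodule A M) := by
  refine Submodule.smul_induction_on (p := fun x => a • x ∈ I ^ (i + j) • (⊤ : Submodule A M)) hm
    (fun b hb m _ => ?_) fun x y hx hy => ?_
  · rw [smul_smul]
    exact Submodule.smul_mem_smul (pow_mul_mem ha hb) trivial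
  · rw [smul_add]
    exact add_mem hx hy

/-- The product `I^i / I^{i+1} × I^j / I^{j+1} → I^{i+j} / I^{i+j+1}`. -/
def GrRingPiece.mul {i j : ℕ} : GrRingPiece I i → GrRingPiece I j → GrRingPiece I (i + j) :=
  Quotient.map₂ (fun a b => ⟨(a : A) * b, pow_mul_mem a.2 b.2⟩) (by
    intro a a' ha b b' hb
    have ha' := (GrRingPiece.mk_eq_iff a a').1 (Quotient.sound ha)
    have hb' := (GrRingPiece.mk_eq_iff b b').1 (Quotient.sound hb)
    refine Quotient.exact ((GrRingPiece.mk_eq_iff _ _).2 ?_)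
    have h1 : (a - a' : A) * b ∈ I ^ (i + j + 1) := by
      have := pow_mul_mem ha' b.2
      rwa [show i + 1 + j = i + j + 1 by omega] at this
    have h2 : (a' : A) * (b - b') ∈ I ^ (i + (j + 1)) := pow_mul_mem a'.2 hb'
    have := add_mem h1 h2
    rwa [show (a - a' : A) * b + a' * (b - b') = a * b - a' * b' by noncomm_ring] at this)

/-- The action `I^i / I^{i+1} × I^j M / I^{j+1} M → I^{i+j} M / I^{i+j+1} M`. -/
def GrModulePiece.smul {i j : ℕ} :
    GrRingPiece I i → GrModulePiece I M j → GrModulePiece I M (i + j) :=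
  Quotient.map₂ (fun a m => ⟨(a : A) • (m : M), pow_smul_mem a.2 m.2⟩) (by
    intro a a' ha b b' hb
    have ha' := (GrRingPiece.mk_eq_iff a a').1 (Quotient.sound ha)
    have hb' := (GrModulePiece.mk_eq_iff b b').1 (Quotient.sound hb)
    refine Quotient.exact ((GrModulePiece.mk_eq_iff _ _).2 ?_)
    have h1 : (a - a' : A) • (b : M) ∈ I ^ (i + j + 1) • (⊤ : Submodule A M) := by
      have := pow_smul_mem ha' b.2
      rwa [show i + 1 + j = i + j + 1 by omega] at this
    have h2 : (a' : A) • (b - b' : M) ∈ I ^ (i + (j + 1)) • (⊤ : Submodule A M) :=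
      pow_smul_mem a'.2 hb'
    have := add_mem h1 h2
    rwa [show (a - a' : A) • (b : M) + (a' : A) • (b - b' : M) = (a : A) • (b : M) -
      (a' : A) • (b' : M) by rw [sub_smul, smul_sub]; abel] at this)

theorem GrRingPiece.mul_mk {i j : ℕ} (a : ↥(I ^ i)) (b : ↥(I ^ j)) :
    GrRingPiece.mul (GrRingPiece.mk I i a) (GrRingPiece.mk I j b) =
      GrRingPiece.mk I (i + j) ⟨(a : A) * b, pow_mul_mem a.2 b.2⟩ := rfl

theorem GrModulePiece.smul_mk {i j : ℕ} (a : ↥(I ^ i)) (m : ↥(I ^ j • (⊤ : Submodule A M))) :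
    GrModulePiece.smul (GrRingPiece.mk I i a) (GrModulePiece.mk I M j m) =
      GrModulePiece.mk I M (i + j) ⟨(a : A) • (m : M), pow_smul_mem a.2 m.2⟩ := rfl

/-- The class of `1` in `A / I`. -/
def GrRingPiece.one : GrRingPiece I 0 :=
  GrRingPiece.mk I 0 ⟨1, by rw [Submodule.pow_zero, Ideal.one_eq_top]; trivial⟩

instance : GradedMonoid.GMul (GrRingPiece I) := ⟨GrRingPiece.mul⟩

instance : GradedMonoid.GOne (GrRingPiece I) := ⟨GrRingPiece.one⟩

instance : GradedMonoid.GMonoid (GrRingPiece I) where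
  one_mul := by
    rintro ⟨i, a⟩
    obtain ⟨a, rfl⟩ := GrRingPiece.mk_surjective i a
    exact GrRingPiece.sigma_eq (zero_add i) _ _ (one_mul _)
  mul_one := by
    rintro ⟨i, a⟩
    obtain ⟨a, rfl⟩ := GrRingPiece.mk_surjective i a
    exact GrRingPiece.sigma_eq (add_zero i) _ _ (mul_one _)
  mul_assoc := by
    rintro ⟨i, a⟩ ⟨j, b⟩ ⟨k, c⟩
    obtain ⟨a, rfl⟩ := GrRingPiece.mk_surjective i a
    obtain ⟨b, rfl⟩ := GrRingPiece.mk_surjective j b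
    obtain ⟨c, rfl⟩ := GrRingPiece.mk_surjective k c
    exact GrRingPiece.sigma_eq (add_assoc i j k) _ _ (mul_assoc _ _ _)

instance : DirectSum.GRing (GrRingPiece I) where
  mul_zero {i j} a := by
    obtain ⟨a, rfl⟩ := GrRingPiece.mk_surjective i a
    rw [← map_zero (GrRingPiece.mk I j)]
    refine (GrRingPiece.mul_mk _ _).trans ((GrRingPiece.mk_eq_iff _ 0).2 ?_)
    simp
  zero_mul {i j} b := by
    obtain ⟨b, rfl⟩ := GrRingPiece.mk_surjective j b
    rw [← map_zero (GrRingPiece.mk I i)]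
    refine (GrRingPiece.mul_mk _ _).trans ((GrRingPiece.mk_eq_iff _ 0).2 ?_)
    simp
  mul_add {i j} a b c := by
    obtain ⟨a, rfl⟩ := GrRingPiece.mk_surjective i a
    obtain ⟨b, rfl⟩ := GrRingPiece.mk_surjective j b
    obtain ⟨c, rfl⟩ := GrRingPiece.mk_surjective j c
    refine Eq.trans ?_ (map_add (GrRingPiece.mk I (i + j)) _ _)
    exact congrArg (GrRingPiece.mk I (i + j)) (Subtype.ext (mul_add (a : A) b c))
  add_mul {i j} a b c := by
    obtain ⟨a, rfl⟩ := GrRingPiece.mk_surjective i a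
    obtain ⟨b, rfl⟩ := GrRingPiece.mk_surjective i b
    obtain ⟨c, rfl⟩ := GrRingPiece.mk_surjective j c
    refine Eq.trans ?_ (map_add (GrRingPiece.mk I (i + j)) _ _)
    exact congrArg (GrRingPiece.mk I (i + j)) (Subtype.ext (add_mul (a : A) b c))
  natCast n := n • GrRingPiece.one
  natCast_zero := zero_smul _ _
  natCast_succ n := succ_nsmul _ n
  intCast n := n • GrRingPiece.one
  intCast_ofNat n := natCast_zsmul _ n
  intCast_negSucc_ofNat n := negSucc_zsmul _ n

instance : DirectSum.Gmodule (GrRingPiece I) (GrModulePiece I M) where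
  smul := GrModulePiece.smul
  one_smul := by
    rintro ⟨i, m⟩
    obtain ⟨m, rfl⟩ := GrModulePiece.mk_surjective i m
    exact GrModulePiece.sigma_eq (zero_add i) _ _ (one_smul _ _)
  mul_smul := by
    rintro ⟨i, a⟩ ⟨j, b⟩ ⟨k, m⟩
    obtain ⟨a, rfl⟩ := GrRingPiece.mk_surjective i a
    obtain ⟨b, rfl⟩ := GrRingPiece.mk_surjective j b
    obtain ⟨m, rfl⟩ := GrModulePiece.mk_surjective k m
    exact GrModulePiece.sigma_eq (add_assoc i j k) _ _ (mul_smul _ _ _)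
  smul_add {i j} a b c := by
    obtain ⟨a, rfl⟩ := GrRingPiece.mk_surjective i a
    obtain ⟨b, rfl⟩ := GrModulePiece.mk_surjective j b
    obtain ⟨c, rfl⟩ := GrModulePiece.mk_surjective j c
    refine Eq.trans ?_ (map_add (GrModulePiece.mk I M (i + j)) _ _)
    exact congrArg (GrModulePiece.mk I M (i + j)) (Subtype.ext (smul_add (a : A) (b : M) c))
  smul_zero {i j} a := by
    obtain ⟨a, rfl⟩ := GrRingPiece.mk_surjective i a
    rw [← map_zero (GrModulePiece.mk I M j)]
    refine (GrModulePiece.smul_mk _ _).trans ((GrModulePiece.mk_eq_iff _ 0).2 ?_)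
    simp
  add_smul {i j} a b c := by
    obtain ⟨a, rfl⟩ := GrRingPiece.mk_surjective i a
    obtain ⟨b, rfl⟩ := GrRingPiece.mk_surjective i b
    obtain ⟨c, rfl⟩ := GrModulePiece.mk_surjective j c
    refine Eq.trans ?_ (map_add (GrModulePiece.mk I M (i + j)) _ _)
    exact congrArg (GrModulePiece.mk I M (i + j)) (Subtype.ext (add_smul (a : A) b (c : M)))
  zero_smul {i j} b := by
    obtain ⟨b, rfl⟩ := GrModulePiece.mk_surjective j b
    rw [← map_zero (GrRingPiece.mk I i)]
    refine (GrModulePiece.smul_mk _ _).trans ((GrModulePiece.mk_eq_iff _ 0).2 ?_)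
    simp

variable (I M)

/-- The component `I^n / I^{n+1}` of `GrRing I`. -/
def grRingGrading (n : ℕ) : AddSubgroup (GrRing I) := (DirectSum.of (GrRingPiece I) n).range

/-- The component `I^n M / I^{n+1} M` of `GrModule I M` (zero in negative degrees). -/
def grModuleGrading : ℤ → AddSubgroup (GrModule I M) :=
  extendByBot fun n => (DirectSum.of (GrModulePiece I M) n).range

instance : SetLike.GradedMonoid (grRingGrading I) where
  one_mem := ⟨GrRingPiece.one, rfl⟩
  mul_mem := by
    rintro i j _ _ ⟨a, rfl⟩ ⟨b, rfl⟩
    exact ⟨_, (DirectSum.of_mul_of a b).symm⟩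

/-- The identification of `I^n / I^{n+1}` with a component of `GrRing I`. -/
def toGrRingGrading (n : ℕ) : GrRingPiece I n →+ grRingGrading I n :=
  (DirectSum.of (GrRingPiece I) n).rangeRestrict

instance : DirectSum.Decomposition (grRingGrading I) :=
  DirectSum.Decomposition.ofAddHom _
    (DirectSum.toAddMonoid fun n =>
      (DirectSum.of (fun n => grRingGrading I n) n).comp (toGrRingGrading I n))
    (by
      ext n x : 2
      simp only [AddMonoidHom.comp_apply, DirectSum.toAddMonoid_of,
        DirectSum.coeAddMonoidHom_of, AddMonoidHom.id_apply]
      rfl)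
    (by
      ext n x : 2
      obtain ⟨_, a, rfl⟩ := x
      simp only [AddMonoidHom.comp_apply, DirectSum.toAddMonoid_of,
        DirectSum.coeAddMonoidHom_of, AddMonoidHom.id_apply]
      rfl)

instance : GradedRing (grRingGrading I) where

end Gr

end GradedKoszul

open GradedKoszul

/-!
In a minimal resolution `⋯ → P₁ → P₀ → M → 0`, the Koszul condition
`J^k Ker d_n = Ker d_n ∩ J^{k+1} P_n` says precisely that each differential is strict of degree `1`
for the `J`-adic filtrations: `im d ∩ J^{k+1} P_n = d (J^k P_{n+1})`. An exact sequence of strict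
maps stays exact on associated graded modules, because an element whose symbol is killed may be
corrected, without changing the symbol, to an element that is itself killed. Moreover `Gr_J P` is
projective over `Gr_J A` when `P` is projective over `A`, and every associated graded module is
generated in degree `0`. Hence the modules `Gr_J P_n`, with degrees shifted by `n`, form a linear
projective resolution of `Gr_J M`. For the second part take `M = A / J`: its associated graded
module is `A / J` in degree `0`, which is `Gr_J A` modulo its positive part.
-/

namespace GradedKoszul

section Symbols

variable {A : Type u} [Ring A] (I : Ideal A) (M : Type v) [AddCommGroup M] [Module A M]

variable {I} in
theorem mem_pow_zero (a : A) : a ∈ I ^ 0 := by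
  rw [Submodule.pow_zero, Ideal.one_eq_top]
  exact Submodule.mem_top

variable {I M} in
theorem mem_pow_zero_smul_top (x : M) : x ∈ I ^ 0 • (⊤ : Submodule A M) := by
  rw [Submodule.pow_zero, Ideal.one_eq_top, Submodule.top_smul]
  exact Submodule.mem_top

/-- The symbol, in degree `n`, of an element of `I^n`: its class in `I^n / I^{n+1} ⊆ GrRing I`. -/
def GrRing.symbol (n : ℕ) : ↥(I ^ n) →+ GrRing I :=
  (DirectSum.of (GrRingPiece I) n).comp (GrRingPiece.mk I n)

/-- The symbol, in degree `n`, of an element of `I^n M`: its class in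
`I^n M / I^{n+1} M ⊆ GrModule I M`. -/
def GrModule.symbol (n : ℕ) : ↥(I ^ n • (⊤ : Submodule A M)) →+ GrModule I M :=
  (DirectSum.of (GrModulePiece I M) n).comp (GrModulePiece.mk I M n)

variable {I M}

namespace GrRing

theorem symbol_eq_zero_iff {n : ℕ} {a : ↥(I ^ n)} :
    symbol I n a = 0 ↔ (a : A) ∈ I ^ (n + 1) := by
  have h := GrRingPiece.mk_eq_iff a 0
  rw [map_zero, ZeroMemClass.coe_zero, sub_zero] at h
  rw [← h, symbol, AddMonoidHom.comp_apply, ← map_zero (DirectSum.of (GrRingPiece I) n),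
    (DirectSum.of_injective n).eq_iff]

theorem exists_symbol_eq_of (n : ℕ) (z : GrRingPiece I n) :
    ∃ a, symbol I n a = DirectSum.of (GrRingPiece I) n z :=
  (GrRingPiece.mk_surjective n z).imp fun _ h => congrArg (DirectSum.of _ n) h

@[elab_as_elim]
theorem induction {p : GrRing I → Prop} (z : GrRing I) (zero : p 0)
    (symbol : ∀ n a, p (symbol I n a)) (add : ∀ x y, p x → p y → p (x + y)) : p z := by
  induction z using DirectSum.induction_on with
  | zero => exact zero
  | of n z =>
    obtain ⟨a, h⟩ := exists_symbol_eq_of n z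
    exact h ▸ symbol n a
  | add x y hx hy => exact add x y hx hy

theorem symbol_mul_symbol [I.IsTwoSided] {i j : ℕ} (a : ↥(I ^ i)) (b : ↥(I ^ j)) :
    symbol I i a * symbol I j b = symbol I (i + j) ⟨a * b, pow_mul_mem a.2 b.2⟩ :=
  DirectSum.of_mul_of _ _

theorem symbol_mem_grRingGrading [I.IsTwoSided] {n : ℕ} (a : ↥(I ^ n)) :
    symbol I n a ∈ grRingGrading I n :=
  ⟨_, rfl⟩

theorem exists_symbol_eq_of_mem_grRingGrading [I.IsTwoSided] {n : ℕ} {z : GrRing I}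
    (hz : z ∈ grRingGrading I n) : ∃ a, symbol I n a = z := by
  obtain ⟨z, rfl⟩ := hz
  exact exists_symbol_eq_of n z

end GrRing

namespace GrModule

theorem symbol_congr {m n : ℕ} (h : m = n) {x : ↥(I ^ m • (⊤ : Submodule A M))}
    {y : ↥(I ^ n • (⊤ : Submodule A M))} (hxy : (x : M) = y) :
    symbol I M m x = symbol I M n y := by
  subst h
  rw [Subtype.ext hxy]

theorem symbol_eq_zero_iff {n : ℕ} {x : ↥(I ^ n • (⊤ : Submodule A M))} :
    symbol I M n x = 0 ↔ (x : M) ∈ I ^ (n + 1) • (⊤ : Submodule A M) := by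
  have h := GrModulePiece.mk_eq_iff x 0
  rw [map_zero, ZeroMemClass.coe_zero, sub_zero] at h
  rw [← h, symbol, AddMonoidHom.comp_apply, ← map_zero (DirectSum.of (GrModulePiece I M) n),
    (DirectSum.of_injective n).eq_iff]

theorem exists_symbol_eq_of (n : ℕ) (z : GrModulePiece I M n) :
    ∃ x, symbol I M n x = DirectSum.of (GrModulePiece I M) n z :=
  (GrModulePiece.mk_surjective n z).imp fun _ h => congrArg (DirectSum.of _ n) h

@[elab_as_elim]
theorem induction {p : GrModule I M → Prop} (z : GrModule I M) (zero : p 0)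
    (symbol : ∀ n x, p (symbol I M n x)) (add : ∀ x y, p x → p y → p (x + y)) : p z := by
  induction z using DirectSum.induction_on with
  | zero => exact zero
  | of n z =>
    obtain ⟨x, h⟩ := exists_symbol_eq_of n z
    exact h ▸ symbol n x
  | add x y hx hy => exact add x y hx hy

theorem symbol_mem_grModuleGrading {n : ℕ} (x : ↥(I ^ n • (⊤ : Submodule A M))) :
    symbol I M n x ∈ grModuleGrading I M n :=
  ⟨_, rfl⟩

theorem exists_symbol_eq_of_mem_grModuleGrading {n : ℕ} {z : GrModule I M}
    (hz : z ∈ grModuleGrading I M n) : ∃ x, symbol I M n x = z := by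
  obtain ⟨z, rfl⟩ := hz
  exact exists_symbol_eq_of n z

theorem eq_zero_or_exists_symbol_eq_of_mem_grModuleGrading {j : ℤ} {z : GrModule I M}
    (hz : z ∈ grModuleGrading I M j) : z = 0 ∨ ∃ (n : ℕ) (x : _), j = n ∧ symbol I M n x = z :=
  match j, hz with
  | .ofNat n, hz => Or.inr ⟨n, (exists_symbol_eq_of_mem_grModuleGrading hz).imp fun _ h => ⟨rfl, h⟩⟩
  | .negSucc _, hz => Or.inl hz

variable {Q : Type*} [AddCommGroup Q]

/-- The additive map out of `I^n M / I^{n+1} M` induced by one on `I^n M` that vanishes on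
`I^{n+1} M`. -/
def liftPiece {n : ℕ} (φ : ↥(I ^ n • (⊤ : Submodule A M)) →+ Q)
    (hφ : ∀ x : ↥(I ^ n • (⊤ : Submodule A M)),
      (x : M) ∈ I ^ (n + 1) • (⊤ : Submodule A M) → φ x = 0) :
    GrModulePiece I M n →+ Q :=
  QuotientAddGroup.lift (Submodule.toAddSubgroup _) φ hφ

/-- The additive map out of `GrModule I M` assembled from additive maps on the `I^n M` that vanish
on `I^{n+1} M`. -/
def liftAddHom (φ : ∀ n, ↥(I ^ n • (⊤ : Submodule A M)) →+ Q)
    (hφ : ∀ n (x : ↥(I ^ n • (⊤ : Submodule A M))),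
      (x : M) ∈ I ^ (n + 1) • (⊤ : Submodule A M) → φ n x = 0) :
    GrModule I M →+ Q :=
  DirectSum.toAddMonoid fun n => liftPiece (φ n) (hφ n)

theorem liftAddHom_symbol (φ : ∀ n, ↥(I ^ n • (⊤ : Submodule A M)) →+ Q) (hφ) {n : ℕ}
    (x : ↥(I ^ n • (⊤ : Submodule A M))) :
    liftAddHom φ hφ (symbol I M n x) = φ n x :=
  DirectSum.toAddMonoid_of (fun n => liftPiece (φ n) (hφ n)) n _

variable [I.IsTwoSided]

theorem symbol_smul_symbol {i j : ℕ} (a : ↥(I ^ i)) (x : ↥(I ^ j • (⊤ : Submodule A M))) :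
    GrRing.symbol I i a • symbol I M j x =
      symbol I M (i + j) ⟨(a : A) • (x : M), pow_smul_mem a.2 x.2⟩ :=
  DirectSum.Gmodule.of_smul_of _ _ _ _

variable [Module (GrRing I) Q]

theorem hom_ext {f g : GrModule I M →ₗ[GrRing I] Q}
    (h : ∀ n x, f (symbol I M n x) = g (symbol I M n x)) : f = g := by
  ext z
  induction z using GrModule.induction with
  | zero => rw [map_zero, map_zero]
  | symbol n x => exact h n x
  | add x y hx hy => rw [map_add, map_add, hx, hy]

/-- The universal property of `GrModule I M`: additive maps on the `I^n M` that vanish on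
`I^{n+1} M` and are compatible with multiplication by symbols assemble to a linear map. -/
def lift (φ : ∀ n, ↥(I ^ n • (⊤ : Submodule A M)) →+ Q)
    (hφ : ∀ n (x : ↥(I ^ n • (⊤ : Submodule A M))),
      (x : M) ∈ I ^ (n + 1) • (⊤ : Submodule A M) → φ n x = 0)
    (hsmul : ∀ i j (a : ↥(I ^ i)) (x : ↥(I ^ j • (⊤ : Submodule A M))),
      φ (i + j) ⟨(a : A) • (x : M), pow_smul_mem a.2 x.2⟩ = GrRing.symbol I i a • φ j x) :
    GrModule I M →ₗ[GrRing I] Q :=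
  { liftAddHom φ hφ with
    map_smul' := fun r z => by
      change liftAddHom φ hφ (r • z) = r • liftAddHom φ hφ z
      induction r using GrRing.induction with
      | zero => rw [zero_smul, zero_smul, map_zero]
      | add r s hr hs => rw [add_smul, add_smul, map_add, hr, hs]
      | symbol i a =>
        induction z using GrModule.induction with
        | zero => rw [smul_zero, map_zero, smul_zero]
        | add x y hx hy => rw [smul_add, map_add, map_add, smul_add, hx, hy]
        | symbol j x => rw [symbol_smul_symbol, liftAddHom_symbol, liftAddHom_symbol, hsmul] }

theorem lift_symbol (φ : ∀ n, ↥(I ^ n • (⊤ : Submodule A M)) →+ Q) (hφ hsmul) {n : ℕ}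
    (x : ↥(I ^ n • (⊤ : Submodule A M))) :
    lift φ hφ hsmul (symbol I M n x) = φ n x :=
  liftAddHom_symbol φ hφ x

end GrModule

end Symbols

section Grading

theorem isInternal_extendByBot_range_of (V : ℕ → Type v) [∀ n, AddCommGroup (V n)] :
    DirectSum.IsInternal (extendByBot fun n => (DirectSum.of V n).range) :=
  letI 𝒱 : ℤ → AddSubgroup (⨁ n, V n) := extendByBot fun n => (DirectSum.of V n).range
  letI : DirectSum.Decomposition 𝒱 :=
    DirectSum.Decomposition.ofAddHom 𝒱
      (DirectSum.toAddMonoid fun n =>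
        (DirectSum.of (fun j => 𝒱 j) (Int.ofNat n)).comp (DirectSum.of V n).rangeRestrict)
      (by
        ext n x : 2
        simp only [AddMonoidHom.comp_apply, DirectSum.toAddMonoid_of, AddMonoidHom.id_apply]
        exact DirectSum.coeAddMonoidHom_of 𝒱 (Int.ofNat n) _)
      (by
        ext j x : 2
        match j, x with
        | .ofNat n, ⟨_, z, rfl⟩ =>
          simp only [AddMonoidHom.comp_apply, DirectSum.toAddMonoid_of,
            DirectSum.coeAddMonoidHom_of, AddMonoidHom.id_apply]
          rfl
        | .negSucc n, x => rw [show x = 0 from Subtype.ext x.2, map_zero, map_zero])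
  DirectSum.Decomposition.isInternal 𝒱

theorem isInternal_addSubgroup_iff_iSupIndep_and_iSup_eq_top {ι : Type*} [DecidableEq ι]
    {M : Type*} [AddCommGroup M] (ℳ : ι → AddSubgroup M) :
    DirectSum.IsInternal ℳ ↔ iSupIndep ℳ ∧ iSup ℳ = ⊤ := by
  have h := DirectSum.isInternal_submodule_iff_iSupIndep_and_iSup_eq_top
    fun i => AddSubgroup.toIntSubmodule (ℳ i)
  have hindep : iSupIndep (fun i => AddSubgroup.toIntSubmodule (ℳ i)) ↔ iSupIndep ℳ :=
    iSupIndep_map_orderIso_iff AddSubgroup.toIntSubmodule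
  rwa [hindep, ← OrderIso.map_iSup, ← AddSubgroup.toIntSubmodule.map_top,
    AddSubgroup.toIntSubmodule.injective.eq_iff] at h

theorem isInternal_comp_equiv {ι κ : Type*} [DecidableEq ι] [DecidableEq κ] {M : Type*}
    [AddCommGroup M] {ℳ : ι → AddSubgroup M} (h : DirectSum.IsInternal ℳ) (e : κ ≃ ι) :
    DirectSum.IsInternal fun k => ℳ (e k) := by
  rw [isInternal_addSubgroup_iff_iSupIndep_and_iSup_eq_top] at h ⊢
  exact ⟨h.1.comp e.injective, (e.iSup_comp (g := ℳ)).trans h.2⟩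

theorem isInternal_map_addEquiv {ι : Type*} [DecidableEq ι] {M N : Type*} [AddCommGroup M]
    [AddCommGroup N] {ℳ : ι → AddSubgroup M} (h : DirectSum.IsInternal ℳ) (e : M ≃+ N) :
    DirectSum.IsInternal fun i => (ℳ i).map e.toAddMonoidHom := by
  rw [isInternal_addSubgroup_iff_iSupIndep_and_iSup_eq_top] at h ⊢
  refine ⟨(iSupIndep_map_orderIso_iff e.mapAddSubgroup).2 h.1, ?_⟩
  rw [← AddSubgroup.map_iSup, h.2]
  exact AddSubgroup.map_top_of_surjective _ e.surjective

variable {A : Type u} [Ring A] (I : Ideal A) [I.IsTwoSided]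
variable (M : Type v) [AddCommGroup M] [Module A M]

theorem isGradedModule_grModuleGrading_sub (s : ℤ) :
    IsGradedModule (grRingGrading I) fun j => grModuleGrading I M (j - s) where
  isInternal := isInternal_comp_equiv (isInternal_extendByBot_range_of _) (Equiv.subRight s)
  smul_mem i j r z hr hz := by
    obtain ⟨a, rfl⟩ := GrRing.exists_symbol_eq_of_mem_grRingGrading hr
    obtain rfl | ⟨n, x, hn, rfl⟩ :=
      GrModule.eq_zero_or_exists_symbol_eq_of_mem_grModuleGrading hz
    · rw [smul_zero]
      exact zero_mem _
    · rw [GrModule.symbol_smul_symbol, add_sub_assoc, hn, ← Nat.cast_add]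
      exact GrModule.symbol_mem_grModuleGrading _

theorem isGradedModule_grModuleGrading :
    IsGradedModule (grRingGrading I) (grModuleGrading I M) := by
  simpa only [sub_zero] using isGradedModule_grModuleGrading_sub I M 0

theorem generatedInDegree_grModuleGrading_zero :
    GeneratedInDegree (GrRing I) (grModuleGrading I M) 0 := by
  let S := Submodule.span (GrRing I) (grModuleGrading I M 0 : Set (GrModule I M))
  have symbol_mem (n : ℕ) (x : ↥(I ^ n • (⊤ : Submodule A M))) : GrModule.symbol I M n x ∈ S := by
    obtain ⟨x, hx⟩ := x
    induction hx using Submodule.smul_induction_on' with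
    | smul a ha x _ =>
      have hmem : GrRing.symbol I n ⟨a, ha⟩ •
          GrModule.symbol I M 0 ⟨x, mem_pow_zero_smul_top x⟩ ∈ S :=
        S.smul_mem _ (Submodule.subset_span (GrModule.symbol_mem_grModuleGrading _))
      rwa [GrModule.symbol_smul_symbol] at hmem
    | add x hx y hy hxS hyS =>
      have hmem := S.add_mem hxS hyS
      rwa [← map_add] at hmem
  refine eq_top_iff.2 fun z _ => ?_
  induction z using GrModule.induction with
  | zero => exact S.zero_mem
  | symbol n x => exact symbol_mem n x
  | add x y hx hy => exact S.add_mem (hx trivial) (hy trivial)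

end Grading

section StrictMaps

variable {A : Type u} [Ring A] {I : Ideal A}
variable {L M N : Type*} [AddCommGroup L] [Module A L] [AddCommGroup M] [Module A M]
  [AddCommGroup N] [Module A N]

theorem map_mem_pow_smul_top_of_range_le [I.IsTwoSided] {f : M →ₗ[A] N} {s : ℕ}
    (hf : LinearMap.range f ≤ I ^ s • (⊤ : Submodule A N)) {n : ℕ} {x : M}
    (hx : x ∈ I ^ n • (⊤ : Submodule A M)) : f x ∈ I ^ (n + s) • (⊤ : Submodule A N) := by
  have hfx : f x ∈ (I ^ n • (⊤ : Submodule A M)).map f := Submodule.mem_map_of_mem hx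
  rw [Submodule.map_smul'', Submodule.map_top] at hfx
  rw [Ideal.IsTwoSided.pow_add, Submodule.mul_smul]
  exact Submodule.smul_mono le_rfl hf hfx

theorem range_le_pow_zero_smul_top (f : M →ₗ[A] N) :
    LinearMap.range f ≤ I ^ 0 • (⊤ : Submodule A N) :=
  fun _ _ => mem_pow_zero_smul_top _

section Map

variable [I.IsTwoSided] (f : M →ₗ[A] N) (s : ℕ)
  (hf : LinearMap.range f ≤ I ^ s • (⊤ : Submodule A N))

/-- The restriction `I^n M → I^(n+s) N` of a linear map `f : M → N` with image in `I^s N`. -/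
def restrictPow (n : ℕ) :
    ↥(I ^ n • (⊤ : Submodule A M)) →+ ↥(I ^ (n + s) • (⊤ : Submodule A N)) :=
  (f.restrict fun _ hx => map_mem_pow_smul_top_of_range_le hf hx).toAddMonoidHom

/-- The map of associated graded modules, raising degrees by `s`, induced by a linear map
`f : M → N` with image in `I^s N`: the symbol of `x` in degree `n` goes to that of `f x` in degree
`n + s`. -/
def GrModule.map : GrModule I M →ₗ[GrRing I] GrModule I N :=
  GrModule.lift
    (fun n => (GrModule.symbol I N (n + s)).comp (restrictPow f s hf n))
    (fun n x hx => GrModule.symbol_eq_zero_iff.2 <| by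
      have hfx := map_mem_pow_smul_top_of_range_le hf hx
      rwa [Nat.add_right_comm] at hfx)
    (fun i j a x => by
      rw [AddMonoidHom.comp_apply, AddMonoidHom.comp_apply, GrModule.symbol_smul_symbol]
      exact GrModule.symbol_congr (add_assoc i j s) (map_smul f (a : A) (x : M)))

namespace GrModule

theorem map_symbol {n : ℕ} (x : ↥(I ^ n • (⊤ : Submodule A M))) :
    map f s hf (symbol I M n x) =
      symbol I N (n + s) ⟨f x, map_mem_pow_smul_top_of_range_le hf x.2⟩ :=
  lift_symbol _ _ _ x

theorem map_mem_grModuleGrading {j : ℤ} {z : GrModule I M} (hz : z ∈ grModuleGrading I M j) :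
    map f s hf z ∈ grModuleGrading I N (j + s) := by
  obtain rfl | ⟨n, x, rfl, rfl⟩ := eq_zero_or_exists_symbol_eq_of_mem_grModuleGrading hz
  · rw [map_zero]
    exact zero_mem _
  · rw [map_symbol, ← Nat.cast_add]
    exact symbol_mem_grModuleGrading _

theorem map_of_apply (z : GrModule I M) (n : ℕ) :
    map f s hf (DirectSum.of _ n (z n)) = DirectSum.of _ (n + s) (map f s hf z (n + s)) := by
  induction z using GrModule.induction with
  | zero => simp only [map_zero, DirectSum.zero_apply]
  | add x y hx hy => simp only [map_add, DirectSum.add_apply, hx, hy]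
  | symbol i x =>
    rw [map_symbol]
    simp only [symbol, AddMonoidHom.comp_apply]
    obtain rfl | hne := eq_or_ne n i
    · rw [DirectSum.of_eq_same, DirectSum.of_eq_same]
      exact map_symbol f s hf x
    · rw [DirectSum.of_eq_of_ne _ _ _ hne, DirectSum.of_eq_of_ne _ _ _ (by omega), map_zero,
        map_zero, map_zero]

theorem ker_map_le_of_symbol_mem {S : Submodule (GrRing I) (GrModule I M)}
    (hS : ∀ n x, map f s hf (symbol I M n x) = 0 → symbol I M n x ∈ S) :
    LinearMap.ker (map f s hf) ≤ S := by
  classical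
  intro z hz
  rw [← DirectSum.sum_support_of z]
  refine Submodule.sum_mem _ fun n _ => ?_
  obtain ⟨x, hx⟩ := exists_symbol_eq_of n (z n)
  rw [← hx]
  apply hS
  rw [hx, map_of_apply, LinearMap.mem_ker.1 hz, DirectSum.zero_apply, map_zero]

end GrModule

end Map

variable (I) in
/-- A linear map `f : M → N` is strict of degree `s` for the `I`-adic filtrations if it maps `M`
into `I^s N` and every element of `f M` lying in `I^(n+s) N` is the image of an element of
`I^n M`. -/
structure IsStrict (s : ℕ) (f : M →ₗ[A] N) : Prop where
  range_le : LinearMap.range f ≤ I ^ s • (⊤ : Submodule A N)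
  inf_le (n : ℕ) : LinearMap.range f ⊓ I ^ (n + s) • (⊤ : Submodule A N) ≤
    (I ^ n • (⊤ : Submodule A M)).map f

theorem isStrict_zero_of_surjective {f : M →ₗ[A] N} (hf : Function.Surjective f) :
    IsStrict I 0 f where
  range_le := range_le_pow_zero_smul_top f
  inf_le n := by
    rw [Submodule.map_smul'', Submodule.map_top, LinearMap.range_eq_top.2 hf]
    exact inf_le_right

namespace IsStrict

variable [I.IsTwoSided] {f : L →ₗ[A] M} {g : M →ₗ[A] N} {s t : ℕ}

theorem symbol_mem_range_map (hf : IsStrict I s f) {n : ℕ}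
    {y : ↥(I ^ n • (⊤ : Submodule A M))} (hy : (y : M) ∈ LinearMap.range f) :
    GrModule.symbol I M n y ∈ LinearMap.range (GrModule.map f s hf.range_le) := by
  obtain hns | hsn := lt_or_ge n s
  · have hy' : (y : M) ∈ I ^ (n + 1) • (⊤ : Submodule A M) :=
      Submodule.smul_mono_left (Ideal.pow_le_pow_right hns) (hf.range_le hy)
    rw [GrModule.symbol_eq_zero_iff.2 hy']
    exact zero_mem _
  · obtain ⟨m, rfl⟩ := Nat.exists_eq_add_of_le' hsn
    obtain ⟨x, hx, hxy⟩ := hf.inf_le m ⟨hy, y.2⟩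
    exact ⟨GrModule.symbol I L m ⟨x, hx⟩,
      (GrModule.map_symbol f s _ _).trans (GrModule.symbol_congr rfl hxy)⟩

theorem exists_symbol_eq_of_map_symbol_eq_zero (hg : IsStrict I t g) {n : ℕ}
    {y : ↥(I ^ n • (⊤ : Submodule A M))}
    (hy : GrModule.map g t hg.range_le (GrModule.symbol I M n y) = 0) :
    ∃ y' : ↥(I ^ n • (⊤ : Submodule A M)),
      (y' : M) ∈ LinearMap.ker g ∧ GrModule.symbol I M n y' = GrModule.symbol I M n y := by
  rw [GrModule.map_symbol, GrModule.symbol_eq_zero_iff, Nat.add_right_comm] at hy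
  obtain ⟨e, he, hge⟩ := hg.inf_le (n + 1) ⟨LinearMap.mem_range_self g _, hy⟩
  have he' : e ∈ I ^ n • (⊤ : Submodule A M) :=
    Submodule.smul_mono_left (Ideal.pow_le_pow_right n.le_succ) he
  refine ⟨y - ⟨e, he'⟩, ?_, ?_⟩
  · rw [AddSubgroupClass.coe_sub, LinearMap.mem_ker, map_sub, hge, sub_self]
  · have hsymbol : GrModule.symbol I M n ⟨e, he'⟩ = 0 := GrModule.symbol_eq_zero_iff.2 he
    rw [map_sub, hsymbol, sub_zero]

theorem exact_map (hf : IsStrict I s f) (hg : IsStrict I t g) (hfg : Function.Exact f g) :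
    Function.Exact (GrModule.map f s hf.range_le) (GrModule.map g t hg.range_le) := by
  refine LinearMap.exact_iff.2 (le_antisymm ?_ ?_)
  · refine GrModule.ker_map_le_of_symbol_mem _ _ _ fun n y hy => ?_
    obtain ⟨y', hy', hsymbol⟩ := hg.exists_symbol_eq_of_map_symbol_eq_zero hy
    rw [← hsymbol]
    exact hf.symbol_mem_range_map ((hfg _).1 hy')
  · refine LinearMap.range_le_ker_iff.2 (GrModule.hom_ext fun n x => ?_)
    rw [LinearMap.comp_apply, GrModule.map_symbol, GrModule.map_symbol, LinearMap.zero_apply,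
      GrModule.symbol_eq_zero_iff]
    change g (f x) ∈ _
    rw [hfg.apply_apply_eq_zero]
    exact zero_mem _

end IsStrict

theorem GrModule.map_surjective [I.IsTwoSided] {f : M →ₗ[A] N} (hf : Function.Surjective f) :
    Function.Surjective (map f 0 (range_le_pow_zero_smul_top (I := I) f)) := by
  rw [← LinearMap.range_eq_top, eq_top_iff, ← generatedInDegree_grModuleGrading_zero,
    Submodule.span_le]
  intro z hz
  obtain ⟨y, rfl⟩ := exists_symbol_eq_of_mem_grModuleGrading (n := 0) hz
  exact (isStrict_zero_of_surjective hf).symbol_mem_range_map (hf _)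

end StrictMaps

section Projective

variable {A : Type u} [Ring A] {I : Ideal A} [I.IsTwoSided]
variable {M : Type v} [AddCommGroup M] [Module A M] {ι : Type*}

theorem apply_mem_pow_of_mem_pow_smul_top {n : ℕ} {f : ι →₀ A}
    (hf : f ∈ I ^ n • (⊤ : Submodule A (ι →₀ A))) (i : ι) : f i ∈ I ^ n := by
  have h := map_mem_pow_smul_top_of_range_le (f := Finsupp.lapply i) (s := 0)
    (range_le_pow_zero_smul_top _) hf
  rwa [add_zero, smul_eq_mul, Ideal.mul_top] at h

namespace GrModule

/-- The coordinatewise symbols, in degree `n`, of a vector of a free module. -/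
noncomputable def finsuppSymbol (n : ℕ) :
    ↥(I ^ n • (⊤ : Submodule A (ι →₀ A))) →+ (ι →₀ GrRing I) where
  toFun f := Finsupp.onFinset f.1.support
    (fun i => GrRing.symbol I n ⟨f.1 i, apply_mem_pow_of_mem_pow_smul_top f.2 i⟩)
    fun i hi => Finsupp.mem_support_iff.2 fun h =>
      hi (GrRing.symbol_eq_zero_iff.2 (by simpa only [h] using zero_mem _))
  map_zero' := Finsupp.ext fun _ => map_zero (GrRing.symbol I n)
  map_add' f g := Finsupp.ext fun i => map_add (GrRing.symbol I n)
    ⟨f.1 i, apply_mem_pow_of_mem_pow_smul_top f.2 i⟩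
    ⟨g.1 i, apply_mem_pow_of_mem_pow_smul_top g.2 i⟩

/-- The linear map, from the associated graded module of a free module to a free module over the
associated graded ring, that takes symbols coordinatewise. -/
noncomputable def toFinsupp : GrModule I (ι →₀ A) →ₗ[GrRing I] (ι →₀ GrRing I) :=
  lift finsuppSymbol
    (fun _ _ hf => Finsupp.ext fun i =>
      GrRing.symbol_eq_zero_iff.2 (apply_mem_pow_of_mem_pow_smul_top hf i))
    (fun _ _ a f => Finsupp.ext fun i =>
      (GrRing.symbol_mul_symbol a ⟨f.1 i, apply_mem_pow_of_mem_pow_smul_top f.2 i⟩).symm)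

theorem toFinsupp_symbol_single (i : ι) (a : A) :
    toFinsupp (symbol I _ 0 ⟨Finsupp.single i a, mem_pow_zero_smul_top _⟩) =
      Finsupp.single i (GrRing.symbol I 0 ⟨a, mem_pow_zero a⟩) := by
  ext j : 1
  rw [toFinsupp, lift_symbol]
  change GrRing.symbol I 0 ⟨Finsupp.single i a j, _⟩ = _
  obtain rfl | hne := eq_or_ne j i
  · simp only [Finsupp.single_eq_same]
  · simp only [Finsupp.single_eq_of_ne hne]
    exact map_zero _

theorem linearCombination_symbol_comp_toFinsupp (v : ι → M) :
    Finsupp.linearCombination (GrRing I)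
        (fun i => symbol I M 0 ⟨v i, mem_pow_zero_smul_top _⟩) ∘ₗ toFinsupp =
      map (Finsupp.linearCombination A v) 0 (range_le_pow_zero_smul_top _) := by
  refine LinearMap.ext_on (generatedInDegree_grModuleGrading_zero I (ι →₀ A)) fun z hz => ?_
  obtain ⟨⟨f, hf⟩, rfl⟩ := exists_symbol_eq_of_mem_grModuleGrading (n := 0) hz
  clear hz
  induction f using Finsupp.induction_linear with
  | zero =>
    have hzero : symbol I (ι →₀ A) 0 ⟨0, hf⟩ = 0 := map_zero (symbol I (ι →₀ A) 0)
    rw [hzero, map_zero, map_zero]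
  | add f g ihf ihg =>
    have h := congrArg₂ (· + ·) (ihf (mem_pow_zero_smul_top f)) (ihg (mem_pow_zero_smul_top g))
    simp only [← map_add] at h
    exact h
  | single i a =>
    rw [LinearMap.comp_apply, toFinsupp_symbol_single, Finsupp.linearCombination_single,
      symbol_smul_symbol, map_symbol]
    exact symbol_congr rfl (Finsupp.linearCombination_single A a i).symm

instance projective [Module.Projective A M] : Module.Projective (GrRing I) (GrModule I M) := by
  obtain ⟨s, hs⟩ := Module.projective_def.1 ‹Module.Projective A M›
  refine Module.Projective.of_split (toFinsupp ∘ₗ map s 0 (range_le_pow_zero_smul_top s))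
    (Finsupp.linearCombination (GrRing I)
      fun x => symbol I M 0 ⟨x, mem_pow_zero_smul_top x⟩) ?_
  have hcomp := linearCombination_symbol_comp_toFinsupp (I := I) (id : M → M)
  simp only [id] at hcomp
  rw [← LinearMap.comp_assoc, hcomp]
  refine hom_ext fun n x => ?_
  rw [LinearMap.comp_apply, map_symbol, map_symbol]
  exact symbol_congr rfl (hs x)

end GrModule

end Projective

section Semisimple

variable {A : Type u} [Ring A]

/-- The ring homomorphism sending `a` to its symbol in degree `0`. -/
def symbolZeroHom (I : Ideal A) [I.IsTwoSided] : A →+* grRingGrading I 0 where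
  toFun a := ⟨GrRing.symbol I 0 ⟨a, mem_pow_zero a⟩, GrRing.symbol_mem_grRingGrading _⟩
  map_one' := rfl
  map_mul' a b := Subtype.ext
    (GrRing.symbol_mul_symbol (I := I) ⟨a, mem_pow_zero a⟩ ⟨b, mem_pow_zero b⟩).symm
  map_zero' := Subtype.ext (map_zero (GrRing.symbol I 0))
  map_add' a b := Subtype.ext
    (map_add (GrRing.symbol I 0) ⟨a, mem_pow_zero a⟩ ⟨b, mem_pow_zero b⟩)

theorem symbolZeroHom_surjective (I : Ideal A) [I.IsTwoSided] :
    Function.Surjective (symbolZeroHom I) := by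
  rintro ⟨z, hz⟩
  obtain ⟨a, rfl⟩ := GrRing.exists_symbol_eq_of_mem_grRingGrading hz
  exact ⟨a, rfl⟩

theorem symbolZeroHom_eq_zero {I : Ideal A} [I.IsTwoSided] {a : A} (ha : a ∈ I) :
    symbolZeroHom I a = 0 :=
  Subtype.ext (GrRing.symbol_eq_zero_iff.2 (by rwa [zero_add, Submodule.pow_one]))

theorem isSemisimpleRing_grRingGrading_zero (I : Ideal A) [I.IsTwoSided]
    [IsSemisimpleRing (A ⧸ I)] : IsSemisimpleRing (grRingGrading I 0) :=
  (Ideal.Quotient.lift I (symbolZeroHom I) fun _ => symbolZeroHom_eq_zero)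
    |>.isSemisimpleRing_of_surjective
      (Ideal.Quotient.lift_surjective_of_surjective I _ (symbolZeroHom_surjective I))

theorem isSemisimpleRing_quotient_gradedJacobson (𝒜 : ℕ → AddSubgroup A) [GradedRing 𝒜]
    [IsSemisimpleRing (𝒜 0 ⧸ Ring.jacobson (𝒜 0))] : IsSemisimpleRing (A ⧸ gradedJacobson 𝒜) :=
  have hker : RingHom.ker ((Ideal.Quotient.mk (Ring.jacobson (𝒜 0))).comp
      (GradedRing.projZeroRingHom' 𝒜)) = gradedJacobson 𝒜 := by
    rw [gradedJacobson, ← RingHom.comap_ker, Ideal.mk_ker]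
  have hsurjective := Ideal.Quotient.mk_surjective.comp (GradedRing.projZeroRingHom'_surjective 𝒜)
  ((RingHom.quotientKerEquivOfSurjective hsurjective).symm.trans
    (Ideal.quotEquivOfEq hker)).isSemisimpleRing

end Semisimple

section Koszul

variable {A : Type u} [Ring A] {𝒜 : ℕ → AddSubgroup A}
variable {M : Type v} [AddCommGroup M] [Module A M] {ℳ : ℤ → AddSubgroup M}

namespace GradedProjectiveResolution

variable (R : GradedProjectiveResolution.{u, v, w} 𝒜 ℳ)

theorem range_d_eq_kernel (n : ℕ) : LinearMap.range (R.d n) = R.kernel n :=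
  match n with
  | 0 => R.exact_zero.linearMap_ker_eq.symm
  | n + 1 => (R.exact n).linearMap_ker_eq.symm

theorem isStrict_d {I : Ideal A} (n : ℕ) (hmin : LinearMap.range (R.d n) ≤ I • ⊤)
    (hkernel : ∀ k, I ^ k • R.kernel n = R.kernel n ⊓ I ^ (k + 1) • (⊤ : Submodule A (R.P n))) :
    IsStrict I 1 (R.d n) where
  range_le := by rwa [Submodule.pow_one]
  inf_le k := by
    rw [Submodule.map_smul'', Submodule.map_top, range_d_eq_kernel, hkernel]

/-- The associated graded of a resolution whose differentials are strict of degree `1`. As these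
raise degrees by `1`, the grading of `GrModule I (P n)` is shifted by `n`. -/
def gr (I : Ideal A) [I.IsTwoSided] (hd : ∀ n, IsStrict I 1 (R.d n)) :
    GradedProjectiveResolution (grRingGrading I) (grModuleGrading I M) where
  P n := GrModule I (R.P n)
  grading n j := grModuleGrading I (R.P n) (j - n)
  isGraded n := isGradedModule_grModuleGrading_sub I (R.P n) n
  projective n :=
    have := R.projective n
    GrModule.projective
  d n := GrModule.map (R.d n) 1 (hd n).range_le
  ε := GrModule.map R.ε 0 (range_le_pow_zero_smul_top R.ε)
  d_mem n j z hz := by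
    have h := GrModule.map_mem_grModuleGrading (R.d n) 1 (hd n).range_le hz
    rwa [Nat.cast_succ, Nat.cast_one, sub_add_eq_sub_sub, sub_add_cancel] at h
  ε_mem j z hz := by
    have h := GrModule.map_mem_grModuleGrading R.ε 0 (range_le_pow_zero_smul_top R.ε) hz
    rwa [Nat.cast_zero, sub_zero, add_zero] at h
  exact n := (hd (n + 1)).exact_map (hd n) (R.exact n)
  exact_zero := (hd 0).exact_map (isStrict_zero_of_surjective R.surjective) R.exact_zero
  surjective := GrModule.map_surjective R.surjective

theorem isLinear_gr (I : Ideal A) [I.IsTwoSided] (hd : ∀ n, IsStrict I 1 (R.d n)) :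
    (R.gr I hd).IsLinear := by
  intro n
  have h := generatedInDegree_grModuleGrading_zero I (R.P n)
  rwa [GeneratedInDegree, ← sub_self (n : ℤ)] at h

end GradedProjectiveResolution

theorem IsKoszulModule.isClassicallyKoszulModule_grModuleGrading [GradedRing 𝒜]
    [IsSemisimpleRing (𝒜 0 ⧸ Ring.jacobson (𝒜 0))] (hM : IsKoszulModule 𝒜 ℳ) :
    IsClassicallyKoszulModule (grRingGrading (gradedJacobson 𝒜))
      (grModuleGrading (gradedJacobson 𝒜) M) := by
  obtain ⟨-, R, hmin, hkernel⟩ := hM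
  have := isSemisimpleRing_quotient_gradedJacobson 𝒜
  exact ⟨isSemisimpleRing_grRingGrading_zero _, isGradedModule_grModuleGrading _ M,
    generatedInDegree_grModuleGrading_zero _ M, R.gr _ _,
    R.isLinear_gr _ fun n => R.isStrict_d n (hmin n) (hkernel n)⟩

theorem IsClassicallyKoszulModule.of_linearEquiv [GradedRing 𝒜] {N : Type v} [AddCommGroup N]
    [Module A N] {𝒩 : ℤ → AddSubgroup N} (h : IsClassicallyKoszulModule 𝒜 ℳ) (e : M ≃ₗ[A] N)
    (he : ∀ j, 𝒩 j = (ℳ j).map e.toAddEquiv.toAddMonoidHom) :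
    IsClassicallyKoszulModule 𝒜 𝒩 := by
  obtain ⟨hsemisimple, hgraded, hgenerated, R, hR⟩ := h
  obtain rfl : 𝒩 = _ := funext he
  refine ⟨hsemisimple, ⟨isInternal_map_addEquiv hgraded.isInternal e.toAddEquiv, ?_⟩, ?_, { R with
    ε := e.toLinearMap ∘ₗ R.ε
    ε_mem := fun i x hx => ⟨_, R.ε_mem i x hx, rfl⟩
    exact_zero := fun x => by
      rw [LinearMap.comp_apply, LinearEquiv.coe_coe, e.map_eq_zero_iff]
      exact R.exact_zero x
    surjective := e.surjective.comp R.surjective }, hR⟩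
  · rintro i j a _ ha ⟨m, hm, rfl⟩
    exact ⟨a • m, hgraded.smul_mem i j a m ha hm, map_smul e a m⟩
  · refine (Submodule.span_image e.toLinearMap).trans ?_
    rw [hgenerated, Submodule.map_top, LinearEquiv.range]

end Koszul

section Quotient

variable {A : Type u} [Ring A] {I : Ideal A}

theorem mkQ_mem_pow_smul_top {n : ℕ} {a : A} (ha : a ∈ I ^ n) :
    I.mkQ a ∈ I ^ n • (⊤ : Submodule A (A ⧸ I)) := by
  have h := Submodule.smul_mem_smul ha (Submodule.mem_top (x := I.mkQ (1 : A)))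
  rwa [← map_smul, smul_eq_mul, mul_one] at h

variable [I.IsTwoSided]

theorem exists_mkQ_eq_of_mem_pow_smul_top {n : ℕ} {x : A ⧸ I}
    (hx : x ∈ I ^ n • (⊤ : Submodule A (A ⧸ I))) : ∃ a ∈ I ^ n, I.mkQ a = x := by
  rwa [← Submodule.range_mkQ, ← Submodule.map_top, ← Submodule.map_smul'', smul_eq_mul,
    Ideal.mul_top] at hx

theorem pow_succ_smul_top_quotient (n : ℕ) : I ^ (n + 1) • (⊤ : Submodule A (A ⧸ I)) = ⊥ := by
  refine eq_bot_iff.2 fun x hx => ?_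
  obtain ⟨a, ha, rfl⟩ := exists_mkQ_eq_of_mem_pow_smul_top hx
  exact (Submodule.Quotient.mk_eq_zero I).2 (Ideal.pow_le_self n.succ_ne_zero ha)

namespace GrRing

variable (I) in
/-- The surjection of `GrRing I` onto the associated graded module of `A / I` that takes the unit to
the symbol of its class. -/
def toGrModuleQuotient : GrRing I →ₗ[GrRing I] GrModule I (A ⧸ I) :=
  LinearMap.toSpanSingleton _ _ (GrModule.symbol I _ 0 ⟨I.mkQ 1, mem_pow_zero_smul_top _⟩)

theorem toGrModuleQuotient_symbol {n : ℕ} (a : ↥(I ^ n)) :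
    toGrModuleQuotient I (symbol I n a) =
      GrModule.symbol I _ n ⟨I.mkQ a, mkQ_mem_pow_smul_top a.2⟩ := by
  rw [toGrModuleQuotient, LinearMap.toSpanSingleton_apply, GrModule.symbol_smul_symbol]
  refine GrModule.symbol_congr (add_zero n) ?_
  change (a : A) • I.mkQ 1 = I.mkQ a
  rw [← map_smul, smul_eq_mul, mul_one]

theorem map_toGrModuleQuotient_grRingGrading (n : ℕ) :
    (grRingGrading I n).map (toGrModuleQuotient I).toAddMonoidHom =
      grModuleGrading I (A ⧸ I) n := by
  refine le_antisymm ?_ fun z hz => ?_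
  · rintro _ ⟨z, hz, rfl⟩
    obtain ⟨a, rfl⟩ := exists_symbol_eq_of_mem_grRingGrading hz
    exact ⟨_, (toGrModuleQuotient_symbol a).symm⟩
  · obtain ⟨⟨x, hx⟩, rfl⟩ := GrModule.exists_symbol_eq_of_mem_grModuleGrading hz
    obtain ⟨a, ha, rfl⟩ := exists_mkQ_eq_of_mem_pow_smul_top hx
    exact ⟨symbol I n ⟨a, ha⟩, symbol_mem_grRingGrading _, toGrModuleQuotient_symbol _⟩

theorem toGrModuleQuotient_surjective : Function.Surjective (toGrModuleQuotient I) := by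
  rw [← LinearMap.range_eq_top, eq_top_iff, ← generatedInDegree_grModuleGrading_zero,
    Submodule.span_le]
  intro z hz
  have hz' : z ∈ grModuleGrading I (A ⧸ I) (0 : ℕ) := hz
  rw [← map_toGrModuleQuotient_grRingGrading] at hz'
  obtain ⟨r, -, rfl⟩ := hz'
  exact ⟨r, rfl⟩

theorem toGrModuleQuotient_symbol_zero_eq_zero_iff {a : ↥(I ^ 0)} :
    toGrModuleQuotient I (symbol I 0 a) = 0 ↔ symbol I 0 a = 0 := by
  rw [toGrModuleQuotient_symbol, GrModule.symbol_eq_zero_iff, pow_succ_smul_top_quotient,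
    symbol_eq_zero_iff, zero_add, Submodule.pow_one]
  exact Submodule.Quotient.mk_eq_zero I

theorem toGrModuleQuotient_symbol_succ {n : ℕ} (a : ↥(I ^ (n + 1))) :
    toGrModuleQuotient I (symbol I (n + 1) a) = 0 := by
  rw [toGrModuleQuotient_symbol, GrModule.symbol_eq_zero_iff]
  have h := mkQ_mem_pow_smul_top a.2
  rwa [pow_succ_smul_top_quotient] at h ⊢

theorem toGrModuleQuotient_eq (z : GrRing I) :
    toGrModuleQuotient I z = toGrModuleQuotient I (DirectSum.of _ 0 (z 0)) := by
  induction z using GrRing.induction with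
  | zero => rw [DirectSum.zero_apply, map_zero, map_zero, map_zero]
  | add x y hx hy => rw [DirectSum.add_apply, map_add, map_add, map_add, hx, hy]
  | symbol n a =>
    cases n with
    | zero => rw [symbol, AddMonoidHom.comp_apply, DirectSum.of_eq_same]
    | succ n =>
      rw [toGrModuleQuotient_symbol_succ, symbol, AddMonoidHom.comp_apply,
        DirectSum.of_eq_of_ne _ _ _ n.succ_ne_zero.symm, map_zero, map_zero]

theorem decompose_grRingGrading (z : GrRing I) (n : ℕ) :
    (DirectSum.decompose (grRingGrading I) z n : GrRing I) = DirectSum.of _ n (z n) := by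
  induction z using GrRing.induction with
  | zero => simp only [DirectSum.decompose_zero, DirectSum.zero_apply, map_zero]; rfl
  | add x y hx hy =>
    rw [DirectSum.decompose_add, DirectSum.add_apply, DirectSum.add_apply, map_add,
      AddSubgroup.coe_add, hx, hy]
  | symbol m a =>
    obtain rfl | hne := eq_or_ne n m
    · rw [DirectSum.decompose_of_mem_same _ (symbol_mem_grRingGrading a), symbol,
        AddMonoidHom.comp_apply, DirectSum.of_eq_same]
    · rw [DirectSum.decompose_of_mem_ne _ (symbol_mem_grRingGrading a) hne.symm, symbol,
        AddMonoidHom.comp_apply, DirectSum.of_eq_of_ne _ _ _ hne, map_zero]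

theorem ker_toGrModuleQuotient :
    LinearMap.ker (toGrModuleQuotient I) = positivePart (grRingGrading I) := by
  ext z
  obtain ⟨a, ha⟩ := exists_symbol_eq_of 0 (z 0)
  rw [LinearMap.mem_ker, toGrModuleQuotient_eq, positivePart, RingHom.mem_ker,
    ← ZeroMemClass.coe_eq_zero, GradedRing.coe_projZeroRingHom'_apply,
    GradedRing.projZeroRingHom_apply, decompose_grRingGrading, ← ha,
    toGrModuleQuotient_symbol_zero_eq_zero_iff]

end GrRing

theorem isClassicallyKoszulRing_grRingGrading
    (h : IsClassicallyKoszulModule (grRingGrading I) (grModuleGrading I (A ⧸ I))) :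
    IsClassicallyKoszulRing (grRingGrading I) := by
  let e : (GrRing I ⧸ positivePart (grRingGrading I)) ≃ₗ[GrRing I] GrModule I (A ⧸ I) :=
    (Submodule.quotEquivOfEq _ _ GrRing.ker_toGrModuleQuotient.symm).trans
      ((GrRing.toGrModuleQuotient I).quotKerEquivOfSurjective GrRing.toGrModuleQuotient_surjective)
  refine h.of_linearEquiv e.symm fun j => ?_
  match j with
  | .ofNat n =>
    change _ = (grModuleGrading I (A ⧸ I) n).map _
    rw [← GrRing.map_toGrModuleQuotient_grRingGrading, AddSubgroup.map_map]
    refine congrArg (fun f => (grRingGrading I n).map f) (AddMonoidHom.ext fun r => ?_)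
    exact (e.symm_apply_eq.2 rfl).symm
  | .negSucc _ => exact (AddSubgroup.map_bot _).symm

end Quotient

end GradedKoszul

theorem theorem5_general {A : Type u} [Ring A] (𝒜 : ℕ → AddSubgroup A) [GradedRing 𝒜]
    [IsSemisimpleRing (𝒜 0 ⧸ Ring.jacobson (𝒜 0))] :
    (∀ (M : Type v) [AddCommGroup M] [Module A M] (ℳ : ℤ → AddSubgroup M),
      IsKoszulModule 𝒜 ℳ →
        IsClassicallyKoszulModule (grRingGrading (gradedJacobson 𝒜))
          (grModuleGrading (gradedJacobson 𝒜) M)) ∧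
    (IsKoszulRing 𝒜 → IsClassicallyKoszulRing (grRingGrading (gradedJacobson 𝒜))) :=
  ⟨fun _ _ _ _ hM => hM.isClassicallyKoszulModule_grModuleGrading,
    fun hA => isClassicallyKoszulRing_grRingGrading hA.isClassicallyKoszulModule_grModuleGrading⟩

theorem theorem5 {A : Type u} [Ring A] (𝒜 : ℕ → AddSubgroup A) [GradedRing 𝒜]
    (hnoeth : IsNoetherianRing (𝒜 0)) (hsemiperfect : IsSemiperfectRing (𝒜 0))
    (hfinite : LeftFinite 𝒜) (hgen : GeneratedInDegreeOne 𝒜) :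
    (∀ (M : Type v) [AddCommGroup M] [Module A M] (ℳ : ℤ → AddSubgroup M),
      IsKoszulModule 𝒜 ℳ →
        IsClassicallyKoszulModule (grRingGrading (gradedJacobson 𝒜))
          (grModuleGrading (gradedJacobson 𝒜) M)) ∧
    (IsKoszulRing 𝒜 → IsClassicallyKoszulRing (grRingGrading (gradedJacobson 𝒜))) :=
  have := hsemiperfect.semisimple
  theorem5_general 𝒜
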